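/- Let $\mathbb N=\{1,2,3,\dots\}$. For $\alpha\in\mathbb R$ let $\phi_\alpha,\psi_\alpha:\mathbb R\to\mathbb R$ be given by $\phi_\alpha(x)=|x|^\alpha$ and $\psi_\alpha(x)=\operatorname{sgn}(x)|x|^\alpha$ for $x\neq 0$, and $\phi_\alpha(0)=\psi_\alpha(0)=0$. For a Hermitian matrix $A=UDU^*$ with $U$ unitary and $D=\operatorname{diag}(d_1,\dots,d_m)$ real, and $f:\mathbb R\to\mathbb R$, put $f(A)=U\operatorname{diag}(f(d_1),\dots,f(d_m))U^*$. For a block matrix $H=(H_{st})_{s,t=1}^n$ with $m\times m$ Hermitian blocks $H_{st}$, put $f^{[m]}[H]=(f(H_{st}))_{s,t=1}^n$. **Theorem.** Let $\alpha\in\mathbb R\setminus\{0\}$ and let $m,n\ge 2$ be integers. 1. The matrix $\phi_\alpha^{[m]}[H]$ is positive semidefinite for every positive semidefinite complex $mn\times mn$ matrix $H=(H_{st})_{s,t=1}^n$ whose $m\times m$ blocks $H_{st}$ are Hermitian and pairwise commute, if and only if $\alpha\in 2\mathbb N\cup[n-2,\infty)$. Moreover, if $\alpha\notin 2\mathbb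 N\cup[n-2,\infty)$, there exist pairwise commuting real symmetric $m\times m$ matrices $H_{st}$ $(1\le s,t\le n)$ such that $H=(H_{st})$ is positive semidefinite but $\phi_\alpha^{[m]}[H]$ is not. 2. The matrix $\psi_\alpha^{[m]}[H]$ is positive semidefinite for every positive semidefinite complex $mn\times mn$ matrix $H=(H_{st})_{s,t=1}^n$ whose $m\times m$ blocks $H_{st}$ are Hermitian and pairwise commute, if and only if $\alpha\in(-1+2\mathbb N)\cup[n-2,\infty)$. Moreover, if $\alpha\notin(-1+2\mathbb N)\cup[n-2,\infty)$, there exist pairwise commuting real symmetric $m\times m$ matrices $H_{st}$ $(1\le s,t\le n)$ such that $H=(H_{st})$ is positive semidefinite but $\psi_\alpha^{[m]}[H]$ is not. -/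

import Mathlib

open scoped ComplexOrder

/-- Even extension to the real line of the power function `x ↦ x ^ α`, with value `0` at `0`. -/
noncomputable def phi (α : ℝ) (x : ℝ) : ℝ :=
  if x = 0 then 0 else |x| ^ α

/-- Odd extension to the real line of the power function `x ↦ x ^ α`, with value `0` at `0`. -/
noncomputable def psi (α : ℝ) (x : ℝ) : ℝ :=
  if x = 0 then 0 else Real.sign x * |x| ^ α

/-- The functional calculus applied to every block: block `(s, t)` of `blockMap f H` is `f (H s t)`.
For a Hermitian block `A = U D U*` (`U` unitary, `D` real diagonal) Mathlib's `cfc f A` is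
`U f(D) U*`, for an arbitrary function `f`, since the spectrum is finite
(see `blockMap_apply_of_isHermitian`). -/
noncomputable def blockMap {𝕜 : Type*} [RCLike 𝕜] {n m : ℕ} (f : ℝ → ℝ)
    (H : Matrix (Fin n) (Fin n) (Matrix (Fin m) (Fin m) 𝕜)) :
    Matrix (Fin n) (Fin n) (Matrix (Fin m) (Fin m) 𝕜) :=
  Matrix.of fun s t => cfc f (H s t)

theorem blockMap_apply_of_isHermitian {𝕜 : Type*} [RCLike 𝕜] {n m : ℕ} (f : ℝ → ℝ)
    (H : Matrix (Fin n) (Fin n) (Matrix (Fin m) (Fin m) 𝕜)) (s t : Fin n)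
    (h : (H s t).IsHermitian) :
    blockMap f H s t = (h.eigenvectorUnitary : Matrix (Fin m) (Fin m) 𝕜) *
      Matrix.diagonal (fun i => ((f (h.eigenvalues i) : ℝ) : 𝕜)) *
      star (h.eigenvectorUnitary : Matrix (Fin m) (Fin m) 𝕜) := by
  rw [blockMap, Matrix.of_apply, h.cfc_eq, Matrix.IsHermitian.cfc, Unitary.conjStarAlgAut_apply]
  rfl

/-- The `mn × mn` matrix obtained from an `n × n` array of `m × m` blocks; the row `(s, i)` is
row `i` of block row `s`. -/
def flatten {𝕜 : Type*} {n m : ℕ}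
    (H : Matrix (Fin n) (Fin n) (Matrix (Fin m) (Fin m) 𝕜)) :
    Matrix (Fin n × Fin m) (Fin n × Fin m) 𝕜 :=
  Matrix.comp (Fin n) (Fin n) (Fin m) (Fin m) 𝕜 H

/-- Every block is Hermitian (real symmetric when `𝕜 = ℝ`) and any two blocks commute. -/
def HermitianCommutingBlocks {𝕜 : Type*} [RCLike 𝕜] {n m : ℕ}
    (H : Matrix (Fin n) (Fin n) (Matrix (Fin m) (Fin m) 𝕜)) : Prop :=
  (∀ s t, (H s t).IsHermitian) ∧ ∀ s t u v, Commute (H s t) (H u v)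

/-- The set `2ℕ ∪ [n - 2, ∞)` with `ℕ = {1, 2, 3, …}`. -/
def phiPowers (n : ℕ) : Set ℝ :=
  {α | ∃ k : ℕ, 1 ≤ k ∧ α = 2 * (k : ℝ)} ∪ Set.Ici ((n : ℝ) - 2)

/-- The set `(-1 + 2ℕ) ∪ [n - 2, ∞)` with `ℕ = {1, 2, 3, …}`. -/
def psiPowers (n : ℕ) : Set ℝ :=
  {α | ∃ k : ℕ, 1 ≤ k ∧ α = -1 + 2 * (k : ℝ)} ∪ Set.Ici ((n : ℝ) - 2)

open Matrix Filter Topology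

/-! Pairwise commuting Hermitian blocks are diagonalized by a single unitary `U`. Conjugating by `1
⊗ U` turns `H` into the direct sum of the `m` real `n × n` matrices of joint eigenvalues, and the
functional calculus acts on these entry by entry (`posSemidef_flatten_iff`,
`cfc_unitary_conj_diagonal`). Conversely a real matrix `A` lifts to the scalar blocks `A s t • 1`.
So everything reduces to one question: which powers, applied entrywise, preserve positivity of real
`n × n` matrices with entries of any sign.

Sufficiency: the integer powers that are polynomials follow from the Schur product theorem. For `α ≥
n - 2` the FitzGerald–Horn argument (`EntrywisePreserver.succ_of_hasDerivAt`) integrates along a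
path from a rank one matrix to `A`; differentiation lowers both exponent and dimension by one and
exchanges `phi` and `psi`, and the base is dimension two.

Necessity: a negative power fails on a `2 × 2` matrix. Otherwise the test matrices are built from `1
+ ε y yᵀ` and the test vectors from finite differences, which annihilate low powers. For non-integer
`α` the first surviving binomial coefficient is negative; for an integer of the wrong parity a
border row detects the sign error on the negative axis. -/

/-- A function preserves positive semidefiniteness of real matrices indexed by `ι` when applied
entrywise. -/
def EntrywisePreserver (f : ℝ → ℝ) (ι : Type*) : Prop :=
  ∀ A : Matrix ι ι ℝ, A.PosSemidef → (A.map f).PosSemidef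

theorem posSemidef_real_iff {ι : Type*} [Fintype ι] {A : Matrix ι ι ℝ} :
    A.PosSemidef ↔ (∀ i j, A i j = A j i) ∧ ∀ x : ι → ℝ, 0 ≤ ∑ i, ∑ j, x i * x j * A i j := by
  rw [posSemidef_iff_dotProduct_mulVec]
  refine and_congr ⟨fun h i j => ?_, fun h => ?_⟩ (forall_congr' fun x => ?_)
  · simpa using (h.apply i j).symm
  · ext i j
    simpa using h j i
  · have : star x ⬝ᵥ (A *ᵥ x) = ∑ i, ∑ j, x i * x j * A i j := by
      simp only [dotProduct, mulVec, Finset.mul_sum]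
      refine Finset.sum_congr rfl fun i _ => Finset.sum_congr rfl fun j _ => ?_
      simp
      ring
    rw [this]

theorem posSemidef_gram_real {ι κ : Type*} [Finite ι] [Fintype κ] (u : κ → ι → ℝ) :
    (Matrix.of fun i j => ∑ k, u k i * u k j).PosSemidef := by
  have := Fintype.ofFinite ι
  convert posSemidef_conjTranspose_mul_self (Matrix.of u) using 1
  ext i j
  simp [Matrix.mul_apply]

/-- Extend `A` by zeros to the larger index set, apply `f` there and restrict back; the value `f 0`
on the padding is discarded. Counterexamples in small dimension thereby exclude all larger ones. -/
theorem EntrywisePreserver.of_injective {f : ℝ → ℝ} {ι κ : Type*} [Fintype ι] [Fintype κ]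
    (h : EntrywisePreserver f κ) (e : ι → κ) (he : Function.Injective e) :
    EntrywisePreserver f ι := by
  classical
  intro A hA
  let C : Matrix κ ι ℝ := (1 : Matrix κ κ ℝ).submatrix id e
  have h1 := (h _ (hA.mul_mul_conjTranspose_same C)).submatrix e
  convert h1 using 1
  ext i j
  simp [C, Matrix.mul_apply, Matrix.one_apply, he.eq_iff]

/-! ### Sufficiency -/

theorem phi_of_pos {α x : ℝ} (hx : 0 < x) : phi α x = x ^ α := by
  simp [phi, hx.ne', abs_of_pos hx]

theorem psi_of_pos {α x : ℝ} (hx : 0 < x) : psi α x = x ^ α := by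
  simp [psi, hx.ne', abs_of_pos hx, Real.sign_of_pos hx]

theorem phi_of_neg {α x : ℝ} (hx : x < 0) : phi α x = (-x) ^ α := by
  simp [phi, hx.ne, abs_of_neg hx]

theorem psi_of_neg {α x : ℝ} (hx : x < 0) : psi α x = -(-x) ^ α := by
  simp [psi, hx.ne, abs_of_neg hx, Real.sign_of_neg hx]

@[simp] theorem phi_zero (α : ℝ) : phi α 0 = 0 := by simp [phi]

@[simp] theorem psi_zero (α : ℝ) : psi α 0 = 0 := by simp [psi]

theorem abs_phi {α : ℝ} (hα : 0 < α) (x : ℝ) : |phi α x| = |x| ^ α := by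
  by_cases hx : x = 0
  · simp [hx, Real.zero_rpow hα.ne']
  · simp [phi, hx, abs_of_nonneg (Real.rpow_nonneg (abs_nonneg x) α)]

theorem abs_psi {α : ℝ} (hα : 0 < α) (x : ℝ) : |psi α x| = |x| ^ α := by
  rcases lt_trichotomy x 0 with hx | rfl | hx
  · rw [psi_of_neg hx, abs_neg, abs_of_neg hx, abs_of_nonneg (Real.rpow_nonneg (by linarith) α)]
  · simp [Real.zero_rpow hα.ne']
  · rw [psi_of_pos hx, abs_of_pos hx, abs_of_nonneg (Real.rpow_nonneg (by linarith) α)]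

/-- Differentiation exchanges the even and the odd family, which forces the induction on dimension
to treat both together. -/
theorem hasDerivAt_phi {α : ℝ} (hα : 1 < α) (x : ℝ) :
    HasDerivAt (phi α) (α * psi (α - 1) x) x := by
  have h : phi α = fun x => |x| ^ α := by
    ext y
    by_cases hy : y = 0
    · simp [hy, Real.zero_rpow (by linarith : α ≠ 0)]
    · simp [phi, hy]
  rw [h]
  convert hasDerivAt_abs_rpow x hα using 1
  rcases lt_trichotomy x 0 with hx | rfl | hx
  · rw [psi_of_neg hx, abs_of_neg hx, show α - 1 = (α - 2) + 1 by ring,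
      Real.rpow_add_one (by linarith)]
    ring
  · simp
  · rw [psi_of_pos hx, abs_of_pos hx, show α - 1 = (α - 2) + 1 by ring,
      Real.rpow_add_one (by linarith)]
    ring

theorem hasDerivAt_psi {α : ℝ} (hα : 1 < α) (x : ℝ) :
    HasDerivAt (psi α) (α * phi (α - 1) x) x := by
  rcases lt_trichotomy x 0 with hx | rfl | hx
  · have h1 : HasDerivAt (fun y : ℝ => -(-y) ^ α) (-((-1) * α * (-x) ^ (α - 1))) x :=
      ((hasDerivAt_id x).neg.rpow_const (Or.inr hα.le)).neg
    refine (h1.congr_of_eventuallyEq ?_).congr_deriv ?_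
    · filter_upwards [eventually_lt_nhds hx] with y hy using psi_of_neg hy
    · rw [phi_of_neg hx]
      ring
  -- At `0` both families have absolute value `|y| ^ α`, so the estimate `o(y)` carries over.
  · have h1 : HasDerivAt (fun y : ℝ => |y| ^ α) 0 0 := by simpa using hasDerivAt_abs_rpow 0 hα
    have h2 := h1.isLittleO
    simp only [phi_zero, mul_zero]
    rw [hasDerivAt_iff_isLittleO]
    refine (h2.norm_left.congr_left fun y => ?_).of_norm_left
    simp [abs_psi (show 0 < α by linarith), Real.zero_rpow (by linarith : α ≠ 0),
      abs_of_nonneg (Real.rpow_nonneg (abs_nonneg y) α)]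
  · refine ((Real.hasDerivAt_rpow_const (Or.inr hα.le)).congr_of_eventuallyEq ?_).congr_deriv ?_
    · filter_upwards [eventually_gt_nhds hx] with y hy using psi_of_pos hy
    · rw [phi_of_pos hx]

theorem phi_mul (α x y : ℝ) : phi α (x * y) = phi α x * phi α y := by
  by_cases hx : x = 0
  · simp [hx]
  by_cases hy : y = 0
  · simp [hy]
  simp [phi, hx, hy, abs_mul, Real.mul_rpow]

theorem psi_mul (α x y : ℝ) : psi α (x * y) = psi α x * psi α y := by
  have h (x : ℝ) : psi α x = Real.sign x * phi α x := by
    by_cases hx : x = 0 <;> simp [psi, phi, hx]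
  have hs : Real.sign (x * y) = Real.sign x * Real.sign y := by
    rcases lt_trichotomy x 0 with hx | rfl | hx <;> rcases lt_trichotomy y 0 with hy | rfl | hy <;>
    simp [Real.sign_of_pos, Real.sign_of_neg, mul_pos_of_neg_of_neg, mul_neg_of_neg_of_pos,
      mul_neg_of_pos_of_neg, *]
  rw [h, h, h, hs, phi_mul]
  ring

/-! ### Dimension two and the induction on dimension -/

/-- Entrywise powers preserve positivity of `2 × 2` matrices. -/
theorem entrywisePreserver_fin_two {f : ℝ → ℝ} {α : ℝ} (hα : 0 < α)
    (hf : ∀ x, |f x| = |x| ^ α) (hf0 : ∀ x, 0 ≤ x → 0 ≤ f x) :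
    EntrywisePreserver f (Fin 2) := by
  intro A hA
  have hA' := posSemidef_real_iff.mp hA
  refine posSemidef_real_iff.mpr ⟨fun i j => by simp [hA'.1 i j], fun x => ?_⟩
  have ha : 0 ≤ A 0 0 := hA.diag_nonneg
  have hc : 0 ≤ A 1 1 := hA.diag_nonneg
  have hdet : A 0 1 * A 0 1 ≤ A 0 0 * A 1 1 := by
    have := hA.det_nonneg
    rw [det_fin_two, hA'.1 1 0] at this
    linarith
  have hb : f (A 0 1) * f (A 0 1) ≤ f (A 0 0) * f (A 1 1) := by
    rw [← abs_mul_abs_self (f (A 0 1)), ← abs_of_nonneg (hf0 _ ha), ← abs_of_nonneg (hf0 _ hc),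
      hf, hf, hf, ← Real.mul_rpow (abs_nonneg _) (abs_nonneg _),
      ← Real.mul_rpow (abs_nonneg _) (abs_nonneg _), abs_mul_abs_self, abs_of_nonneg ha,
      abs_of_nonneg hc]
    exact Real.rpow_le_rpow (mul_self_nonneg _) hdet hα.le
  have ha' := hf0 _ ha
  have hc' := hf0 _ hc
  simp only [Fin.sum_univ_two, Matrix.map_apply, hA'.1 1 0]
  generalize f (A 0 0) = a at *
  generalize f (A 1 1) = c at *
  generalize f (A 0 1) = b at *
  rcases ha'.eq_or_lt with rfl | hpos
  · have hb0 : b = 0 := by nlinarith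
    subst hb0
    nlinarith [mul_nonneg (mul_self_nonneg (x 1)) hc']
  · refine nonneg_of_mul_nonneg_right ?_ hpos
    nlinarith [mul_self_nonneg (a * x 0 + b * x 1),
      mul_nonneg (mul_self_nonneg (x 1)) (sub_nonneg.mpr hb)]

/-- Subtracting the rank one matrix that clears the first row and column preserves positivity. -/
theorem posSemidef_sub_rankOne {n : ℕ} {A : Matrix (Fin (n + 1)) (Fin (n + 1)) ℝ}
    (hA : A.PosSemidef) :
    ∃ z : Fin (n + 1) → ℝ, (∀ i, A 0 i = z 0 * z i) ∧
      (Matrix.of fun i j => A i j - z i * z j).PosSemidef := by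
  obtain ⟨hs, hq⟩ := posSemidef_real_iff.mp hA
  have ha : 0 ≤ A 0 0 := hA.diag_nonneg
  -- The quadratic form at `x + t e₀`, expanded in `t`.
  have hpair (x : Fin (n + 1) → ℝ) (t : ℝ) :
      0 ≤ ∑ i, ∑ j, x i * x j * A i j + 2 * t * ∑ i, x i * A 0 i + t * t * A 0 0 := by
    have h := hq (fun i => x i + (Pi.single 0 t : Fin (n + 1) → ℝ) i)
    have e : ∑ i, ∑ j, (x i + (Pi.single 0 t : Fin (n + 1) → ℝ) i) *
        (x j + (Pi.single 0 t : Fin (n + 1) → ℝ) j) * A i j =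
        ∑ i, ∑ j, x i * x j * A i j + 2 * t * ∑ i, x i * A 0 i + t * t * A 0 0 := by
      have e1 : ∑ i, ∑ j, x i * (Pi.single 0 t : Fin (n + 1) → ℝ) j * A i j =
          t * ∑ i, x i * A 0 i := by
        rw [Finset.mul_sum]
        refine Finset.sum_congr rfl fun i _ => ?_
        rw [Finset.sum_eq_single 0 (fun j _ hj => by simp [hj]) (by simp), hs i 0]
        simp
        ring
      have e2 : ∑ i, ∑ j, (Pi.single 0 t : Fin (n + 1) → ℝ) i * x j * A i j =
          t * ∑ i, x i * A 0 i := by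
        rw [Finset.mul_sum, Finset.sum_eq_single 0 (fun j _ hj => by simp [hj]) (by simp)]
        refine Finset.sum_congr rfl fun i _ => ?_
        simp
        ring
      have e3 : ∑ i, ∑ j, (Pi.single 0 t : Fin (n + 1) → ℝ) i *
          (Pi.single 0 t : Fin (n + 1) → ℝ) j * A i j = t * t * A 0 0 := by
        rw [Finset.sum_eq_single 0 (fun j _ hj => by simp [hj]) (by simp),
          Finset.sum_eq_single 0 (fun j _ hj => by simp [hj]) (by simp)]
        simp
      simp only [add_mul, mul_add, Finset.sum_add_distrib]
      rw [e1, e2, e3]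
      ring
    rwa [e] at h
  have hrow : A 0 0 = 0 → ∀ i, A 0 i = 0 := by
    intro h0 i
    by_contra hne
    -- This `t` makes the form at `e_i + t e₀` equal to `-1`.
    have h := hpair (Pi.single i 1) (-(A i i + 1) / (2 * A 0 i))
    have e1 : ∑ k, ∑ j, (Pi.single i 1 : Fin (n + 1) → ℝ) k *
        (Pi.single i 1 : Fin (n + 1) → ℝ) j * A k j = A i i := by
      rw [Finset.sum_eq_single i (fun j _ hj => by simp [hj]) (by simp),
        Finset.sum_eq_single i (fun j _ hj => by simp [hj]) (by simp)]
      simp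
    have e2 : ∑ k, (Pi.single i 1 : Fin (n + 1) → ℝ) k * A 0 k = A 0 i := by
      rw [Finset.sum_eq_single i (fun j _ hj => by simp [hj]) (by simp)]
      simp
    rw [e1, e2, h0] at h
    have : 2 * (-(A i i + 1) / (2 * A 0 i)) * A 0 i = -(A i i + 1) := by
      field_simp
    linarith
  rcases ha.eq_or_lt with h0 | hpos
  · exact ⟨0, by simpa using hrow h0.symm, by simpa using! hA⟩
  have hsq : √(A 0 0) * √(A 0 0) = A 0 0 := Real.mul_self_sqrt ha
  have hne : √(A 0 0) ≠ 0 := (Real.sqrt_pos.mpr hpos).ne'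
  refine ⟨fun i => A 0 i / √(A 0 0), fun i => ?_,
    posSemidef_real_iff.mpr ⟨fun i j => ?_, fun x => ?_⟩⟩
  · field_simp
    rw [sq, hsq]
  · simp [hs i j, mul_comm]
  -- This `t` minimizes the form; the minimum is the form of the Schur complement.
  · have h := hpair x (-(∑ i, x i * A 0 i) / A 0 0)
    have e : ∑ i, ∑ j, x i * x j * (A 0 i / √(A 0 0) * (A 0 j / √(A 0 0))) =
        (∑ i, x i * A 0 i) * (∑ i, x i * A 0 i) / A 0 0 := by
      rw [Finset.sum_mul_sum, Finset.sum_div]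
      refine Finset.sum_congr rfl fun i _ => ?_
      rw [Finset.sum_div]
      refine Finset.sum_congr rfl fun j _ => ?_
      rw [div_mul_div_comm, hsq]
      ring
    simp only [of_apply, mul_sub, Finset.sum_sub_distrib]
    rw [e]
    convert h using 1
    field_simp
    ring

/-- The FitzGerald–Horn induction step: if the derivative `g` of a multiplicative function `f`
preserves positivity in dimension `n`, then `f` does so in dimension `n + 1`. -/
theorem EntrywisePreserver.succ_of_hasDerivAt {n : ℕ} {f g : ℝ → ℝ} {c : ℝ} (hc : 0 ≤ c)
    (hfg : ∀ x, HasDerivAt f (c * g x) x) (hmul : ∀ x y, f (x * y) = f x * f y)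
    (hg : EntrywisePreserver g (Fin n)) : EntrywisePreserver f (Fin (n + 1)) := by
  intro A hA
  obtain ⟨z, hz, hB⟩ := posSemidef_sub_rankOne hA
  obtain ⟨hs, -⟩ := posSemidef_real_iff.mp hA
  set B : Matrix (Fin (n + 1)) (Fin (n + 1)) ℝ := Matrix.of fun i j => A i j - z i * z j with hBdef
  have hB0 (i) : B 0 i = 0 := by simp [hBdef, hz]
  have hB0' (i) : B i 0 = 0 := by simp [hBdef, hs i 0, hz, mul_comm]
  refine posSemidef_real_iff.mpr ⟨fun i j => by simp [hs i j], fun x => ?_⟩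
  -- The form of `f` along the segment from `z zᵀ` (`t = 0`) to `A` (`t = 1`).
  let q : ℝ → ℝ := fun t => ∑ i, ∑ j, x i * x j * f (z i * z j + t * B i j)
  have hq (t : ℝ) : HasDerivAt q
      (∑ i, ∑ j, x i * x j * (c * g (z i * z j + t * B i j) * B i j)) t := by
    refine HasDerivAt.fun_sum fun i _ => HasDerivAt.fun_sum fun j _ => HasDerivAt.const_mul _ ?_
    refine (hfg _).comp t ?_
    simpa using ((hasDerivAt_id t).mul_const (B i j)).const_add (z i * z j)
  have hderiv (t : ℝ) (ht : 0 ≤ t) :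
      0 ≤ ∑ i, ∑ j, x i * x j * (c * g (z i * z j + t * B i j) * B i j) := by
    have h1 : (Matrix.of fun i j => z i * z j + t * B i j).PosSemidef := by
      have := (posSemidef_gram_real fun _ : Unit => z).add (hB.smul ht)
      convert this using 1
      ext i j
      simp
    -- The zero first row and column of `B` cancel every term of the derivative outside an `n × n`
    -- minor, where the Schur product theorem applies.
    have h2 := (hg _ (h1.submatrix Fin.succ)).hadamard (hB.submatrix Fin.succ)
    have h3 := (posSemidef_real_iff.mp h2).2 (fun i => x i.succ)
    simp only [Fin.sum_univ_succ, hB0, hB0', mul_zero, zero_add, Finset.sum_const_zero]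
    have h4 := mul_nonneg hc h3
    rw [Finset.mul_sum] at h4
    refine h4.trans_eq (Finset.sum_congr rfl fun i _ => ?_)
    rw [Finset.mul_sum]
    refine Finset.sum_congr rfl fun j _ => ?_
    simp [hadamard_apply]
    ring
  have hmono : MonotoneOn q (Set.Icc 0 1) := by
    refine monotoneOn_of_deriv_nonneg (convex_Icc 0 1)
      (fun t _ => (hq t).continuousAt.continuousWithinAt)
      (fun t _ => (hq t).differentiableAt.differentiableWithinAt) fun t ht => ?_
    rw [interior_Icc] at ht
    rw [(hq t).deriv]
    exact hderiv t ht.1.le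
  have h01 := hmono (by simp) (by simp) (zero_le_one (α := ℝ))
  -- Multiplicativity keeps the starting point of rank one, so its form is a square.
  have h0 : q 0 = (∑ i, x i * f (z i)) * ∑ i, x i * f (z i) := by
    rw [Finset.sum_mul_sum]
    refine Finset.sum_congr rfl fun i _ => Finset.sum_congr rfl fun j _ => ?_
    rw [zero_mul, add_zero, hmul]
    ring
  have h1 : q 1 = ∑ i, ∑ j, x i * x j * A.map f i j := by
    refine Finset.sum_congr rfl fun i _ => Finset.sum_congr rfl fun j _ => ?_
    simp [hBdef]
  rw [← h1]
  refine le_trans ?_ h01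
  rw [h0]
  exact mul_self_nonneg _

/-- The inequality is strict so that the exponent stays above `1` at each differentiation and
positive in the base case; the endpoint is a limit from the right. -/
theorem entrywisePreserver_phi_psi_of_gt (n : ℕ) {α : ℝ} (hα : (n : ℝ) < α) :
    EntrywisePreserver (phi α) (Fin (n + 2)) ∧ EntrywisePreserver (psi α) (Fin (n + 2)) := by
  induction n generalizing α with
  | zero =>
    have hα : 0 < α := by simpa using hα
    refine ⟨entrywisePreserver_fin_two hα (abs_phi hα) fun x hx => ?_,
      entrywisePreserver_fin_two hα (abs_psi hα) fun x hx => ?_⟩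
    · rcases hx.eq_or_lt with rfl | hx
      · simp
      · rw [phi_of_pos hx]
        positivity
    · rcases hx.eq_or_lt with rfl | hx
      · simp
      · rw [psi_of_pos hx]
        positivity
  | succ n ih =>
    push_cast at hα
    have hα1 : 1 < α := by linarith [Nat.cast_nonneg (α := ℝ) n]
    obtain ⟨h1, h2⟩ := ih (α := α - 1) (by linarith)
    exact ⟨h2.succ_of_hasDerivAt (by linarith) (hasDerivAt_phi hα1) (phi_mul α),
      h1.succ_of_hasDerivAt (by linarith) (hasDerivAt_psi hα1) (psi_mul α)⟩

theorem EntrywisePreserver.of_tendsto {ι : Type*} [Fintype ι] {F : ℝ → ℝ → ℝ} {α : ℝ}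
    (hF : ∀ β > α, EntrywisePreserver (F β) ι)
    (hlim : ∀ x, Tendsto (fun β => F β x) (𝓝[>] α) (𝓝 (F α x))) : EntrywisePreserver (F α) ι := by
  intro A hA
  obtain ⟨hs, -⟩ := posSemidef_real_iff.mp hA
  refine posSemidef_real_iff.mpr ⟨fun i j => by simp [hs i j], fun x => ?_⟩
  have h : Tendsto (fun β => ∑ i, ∑ j, x i * x j * A.map (F β) i j) (𝓝[>] α)
      (𝓝 (∑ i, ∑ j, x i * x j * A.map (F α) i j)) :=
    tendsto_finsetSum _ fun i _ => tendsto_finsetSum _ fun j _ => (hlim _).const_mul _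
  refine ge_of_tendsto h ?_
  filter_upwards [self_mem_nhdsWithin] with β hβ
  exact (posSemidef_real_iff.mp (hF β hβ A hA)).2 x

theorem continuous_phi_exponent (x : ℝ) : Continuous fun α => phi α x := by
  by_cases hx : x = 0
  · simp [hx, continuous_const]
  · simp only [phi, hx, if_false]
    exact Real.continuous_const_rpow (abs_ne_zero.mpr hx)

theorem continuous_psi_exponent (x : ℝ) : Continuous fun α => psi α x := by
  by_cases hx : x = 0
  · simp [hx, continuous_const]
  · simp only [psi, hx, if_false]
    exact continuous_const.mul (Real.continuous_const_rpow (abs_ne_zero.mpr hx))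

theorem entrywisePreserver_phi_psi_of_ge (n : ℕ) {α : ℝ} (hα : (n : ℝ) ≤ α) :
    EntrywisePreserver (phi α) (Fin (n + 2)) ∧ EntrywisePreserver (psi α) (Fin (n + 2)) :=
  ⟨.of_tendsto (fun _ hβ => (entrywisePreserver_phi_psi_of_gt n (hα.trans_lt hβ)).1)
    fun x => ((continuous_phi_exponent x).tendsto α).mono_left nhdsWithin_le_nhds,
  .of_tendsto (fun _ hβ => (entrywisePreserver_phi_psi_of_gt n (hα.trans_lt hβ)).2)
    fun x => ((continuous_psi_exponent x).tendsto α).mono_left nhdsWithin_le_nhds⟩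

/-! ### Polynomial powers and the sufficient conditions -/

theorem entrywisePreserver_pow {ι : Type*} [Finite ι] (k : ℕ) :
    EntrywisePreserver (fun x => x ^ k) ι := by
  intro A hA
  induction k with
  | zero =>
    convert posSemidef_gram_real fun (_ : Unit) (_ : ι) => (1 : ℝ) using 1
    ext i j
    simp
  | succ k ih =>
    have h := ih.hadamard hA
    have e : (A.map fun x => x ^ k) ⊙ A = A.map fun x => x ^ (k + 1) := by
      ext i j
      simp [hadamard_apply, pow_succ]
    exact e ▸ h

theorem phi_even {k : ℕ} (hk : 1 ≤ k) : phi (2 * k) = fun x => x ^ (2 * k) := by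
  ext x
  by_cases hx : x = 0
  · simp [hx, show k ≠ 0 by omega]
  · rw [phi, if_neg hx, ← (even_two_mul k).pow_abs, ← Real.rpow_natCast]
    simp

theorem psi_odd {k : ℕ} (hk : 1 ≤ k) : psi (-1 + 2 * k) = fun x => x ^ (2 * k - 1) := by
  have hc : (-1 + 2 * k : ℝ) = ((2 * k - 1 : ℕ) : ℝ) := by
    push_cast [show 1 ≤ 2 * k by omega]
    ring
  rw [hc]
  have ho : Odd (2 * k - 1) := ⟨k - 1, by omega⟩
  ext x
  rcases lt_trichotomy x 0 with hx | rfl | hx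
  · rw [psi_of_neg hx, Real.rpow_natCast, ho.neg_pow, neg_neg]
  · simp [show 2 * k - 1 ≠ 0 by omega]
  · rw [psi_of_pos hx, Real.rpow_natCast]

theorem entrywisePreserver_phi {n : ℕ} (hn : 2 ≤ n) {α : ℝ} (hα : α ∈ phiPowers n) :
    EntrywisePreserver (phi α) (Fin n) := by
  rcases hα with ⟨k, hk, rfl⟩ | hα
  · rw [phi_even hk]
    exact entrywisePreserver_pow _
  · obtain ⟨n, rfl⟩ := Nat.exists_eq_add_of_le' hn
    exact (entrywisePreserver_phi_psi_of_ge n (by simpa using hα)).1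

theorem entrywisePreserver_psi {n : ℕ} (hn : 2 ≤ n) {α : ℝ} (hα : α ∈ psiPowers n) :
    EntrywisePreserver (psi α) (Fin n) := by
  rcases hα with ⟨k, hk, rfl⟩ | hα
  · rw [psi_odd hk]
    exact entrywisePreserver_pow _
  · obtain ⟨n, rfl⟩ := Nat.exists_eq_add_of_le' hn
    exact (entrywisePreserver_phi_psi_of_ge n (by simpa using hα)).2

/-! ### Necessity -/

/-- The coefficients of the `N`-th forward difference. -/
def differenceCoeff (N i : ℕ) : ℝ := (-1) ^ (N - i) * N.choose i

theorem sum_differenceCoeff_mul (N : ℕ) (f : ℝ → ℝ) (a : ℝ) :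
    ∑ i : Fin (N + 1), differenceCoeff N i * f (a + (i : ℕ)) = (fwdDiff 1)^[N] f a := by
  rw [fwdDiff_iter_eq_sum_shift, Finset.sum_range]
  refine Finset.sum_congr rfl fun i _ => ?_
  simp [differenceCoeff]

/-- Differences of order `N` kill polynomials of lower degree, so this coefficient vector removes
all low-order terms of a binomial expansion. -/
theorem sum_differenceCoeff_mul_pow {N k : ℕ} (hk : k < N) (a : ℝ) :
    ∑ i : Fin (N + 1), differenceCoeff N i * (a + (i : ℕ)) ^ k = 0 := by
  rw [sum_differenceCoeff_mul N (fun x => x ^ k), fwdDiff_iter_pow_eq_zero_of_lt hk]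
  rfl

theorem sum_differenceCoeff_mul_pow_self (N : ℕ) (a : ℝ) :
    ∑ i : Fin (N + 1), differenceCoeff N i * (a + (i : ℕ)) ^ N = N.factorial := by
  rw [sum_differenceCoeff_mul N (fun x => x ^ N), fwdDiff_iter_eq_factorial]
  rfl

theorem sum_sum_mul_pow {ι : Type*} [Fintype ι] (v y : ι → ℝ) (k : ℕ) :
    ∑ i, ∑ j, v i * v j * (y i * y j) ^ k = (∑ i, v i * y i ^ k) ^ 2 := by
  rw [sq, Finset.sum_mul_sum]
  refine Finset.sum_congr rfl fun i _ => Finset.sum_congr rfl fun j _ => ?_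
  ring

/-! ### Integer exponents of the wrong parity -/

/-- A power with the wrong sign on the negative axis does not preserve positivity. -/
theorem not_entrywisePreserver_of_integer {f : ℝ → ℝ} {p : ℕ} (hp : ∀ x, 0 < x → f x = x ^ p)
    (hn : ∀ x < 0, f x = -x ^ p) : ¬ EntrywisePreserver f (Option (Fin (p + 2))) := by
  intro hf
  -- The shift by `-1/2` makes exactly one node negative and none zero; the scaling gives `|y i| <
  -- 1`, hence `1 + y i * y j > 0`.
  set y : Fin (p + 2) → ℝ := fun i => (p + 2 : ℝ)⁻¹ * (-(1 / 2) + (i : ℕ)) with hy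
  set v : Fin (p + 2) → ℝ := fun i => differenceCoeff (p + 1) i with hv
  have hd : (0 : ℝ) < (p + 2 : ℝ)⁻¹ := by positivity
  have hyabs (i) : |y i| < 1 := by
    have h0 : (0 : ℝ) ≤ (i : ℕ) := Nat.cast_nonneg _
    have h1 : ((i : ℕ) : ℝ) ≤ p + 1 := by exact_mod_cast Nat.lt_succ_iff.mp i.2
    have hp0 : (0 : ℝ) ≤ p := Nat.cast_nonneg _
    rw [hy, abs_mul, abs_of_pos hd, inv_mul_lt_iff₀ (by positivity), abs_lt]
    constructor <;> linarith
  have hpos (i j) : 0 < 1 + y i * y j := by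
    have : |y i * y j| < 1 := by
      rw [abs_mul]
      exact mul_lt_one_of_nonneg_of_lt_one_left (abs_nonneg _) (hyabs i) (hyabs j).le
    linarith [neg_abs_le (y i * y j)]
  have hzero {k : ℕ} (hk : k < p + 1) : ∑ i, v i * y i ^ k = 0 := by
    have := sum_differenceCoeff_mul_pow hk (-(1 / 2))
    calc ∑ i, v i * y i ^ k = ((p + 2 : ℝ)⁻¹) ^ k *
        ∑ i : Fin (p + 1 + 1), differenceCoeff (p + 1) i * (-(1 / 2) + (i : ℕ)) ^ k := by
          rw [Finset.mul_sum]
          refine Finset.sum_congr rfl fun i _ => ?_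
          simp only [hy, hv, mul_pow]
          ring
      _ = 0 := by rw [this, mul_zero]
  have hy0 : y 0 < 0 := by
    simp only [hy, Fin.val_zero, Nat.cast_zero, add_zero]
    nlinarith
  -- Since `∑ v i * y i ^ p = 0`, only the sign flip at the negative node `y 0` survives.
  have hS : ∑ i, v i * f (y i) = -2 * v 0 * y 0 ^ p := by
    have h := hzero (Nat.lt_succ_self p)
    rw [Fin.sum_univ_succ] at h ⊢
    have : ∀ i : Fin (p + 1), f (y i.succ) = y i.succ ^ p := fun i => by
      refine hp _ (mul_pos hd ?_)
      have : (0 : ℝ) ≤ (i : ℕ) := Nat.cast_nonneg _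
      push_cast [Fin.val_succ]
      linarith
    simp only [this, hn _ hy0]
    linarith
  have hv0 : v 0 ≠ 0 := by simp [hv, differenceCoeff]
  set S := ∑ i, v i * f (y i) with hSdef
  have hSne : S ≠ 0 := by
    rw [hS]
    exact mul_ne_zero (mul_ne_zero (by norm_num) hv0) (pow_ne_zero _ hy0.ne)
  have hquad : ∑ i, ∑ j, v i * v j * f (1 + y i * y j) = 0 := by
    have e (i j) : v i * v j * f (1 + y i * y j) =
        ∑ k ∈ Finset.range (p + 1), (p.choose k : ℝ) * (v i * v j * (y i * y j) ^ k) := by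
      rw [hp _ (hpos i j), add_comm, add_pow, Finset.mul_sum]
      refine Finset.sum_congr rfl fun k _ => ?_
      ring
    simp only [e]
    rw [Finset.sum_congr rfl fun i _ => Finset.sum_comm, Finset.sum_comm]
    refine Finset.sum_eq_zero fun k hk => ?_
    simp only [← Finset.mul_sum]
    rw [sum_sum_mul_pow, hzero (Finset.mem_range.mp hk)]
    simp
  -- Gram matrix of the vectors `(0, 1)` and `(1, y i)`: the block `1 + y i * y j` bordered by `y
  -- i`, with corner `1`. At `(-S, v)` the form is `S² - 2S² + 0 < 0`.
  let u : Fin 2 → Option (Fin (p + 2)) → ℝ :=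
    ![fun i => i.elim 0 fun _ => 1, fun i => i.elim 1 y]
  have h := (posSemidef_real_iff.mp (hf _ (posSemidef_gram_real u))).2 (fun i => i.elim (-S) v)
  have h1 : f 1 = 1 := by simp [hp 1 one_pos]
  simp only [Fintype.sum_option, Matrix.map_apply, Matrix.of_apply, Fin.sum_univ_two, u,
    Matrix.cons_val_zero, Matrix.cons_val_one, Option.elim, mul_zero, mul_one, one_mul,
    zero_add, h1, Finset.sum_add_distrib, hquad, add_zero] at h
  have e1 : ∑ i, -S * v i * f (y i) = -S * S := by
    rw [hSdef, Finset.mul_sum]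
    exact Finset.sum_congr rfl fun i _ => mul_assoc _ _ _
  have e2 : ∑ i, v i * -S * f (y i) = -S * S := by
    rw [← e1]
    exact Finset.sum_congr rfl fun i _ => by ring
  rw [e1, e2] at h
  nlinarith [mul_self_pos.mpr hSne]

/-! ### Non-integer exponents -/

/-- Of the factors `α, α - 1, …, α - p - 1` of the numerator only the last is negative. -/
theorem ring_choose_neg {α : ℝ} {p : ℕ} (h1 : p < α) (h2 : α < p + 1) :
    Ring.choose α (p + 2) < 0 := by
  have hpos (k : ℕ) (hk : k ≤ p + 1) : 0 < (descPochhammer ℤ k).smeval α := by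
    induction k with
    | zero => simp
    | succ k ih =>
      rw [descPochhammer_succ_right, Polynomial.smeval_mul]
      refine mul_pos (ih (by omega)) ?_
      have : (k : ℝ) ≤ p := by exact_mod_cast (by omega : k ≤ p)
      simp [Polynomial.smeval_natCast]
      linarith
  rw [Ring.choose_eq_smul, descPochhammer_succ_right, Polynomial.smeval_mul, smul_eq_mul]
  refine mul_neg_of_pos_of_neg (by positivity) (mul_neg_of_pos_of_neg (hpos _ le_rfl) ?_)
  simp [Polynomial.smeval_natCast]
  linarith

/-- The binomial expansion of `(1 + x) ^ α` near `0`. -/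
theorem one_add_rpow_isBigO (α : ℝ) (N : ℕ) :
    (fun x : ℝ => (1 + x) ^ α - ∑ k ∈ Finset.range N, Ring.choose α k * x ^ k) =O[𝓝 0]
      fun x => x ^ N := by
  have h := (Real.one_add_rpow_hasFPowerSeriesAt_zero (a := α)).isBigO_sub_partialSum_pow N
  refine (h.congr_left fun x => ?_).trans (Asymptotics.isBigO_of_le _ fun x => by simp)
  simp [FormalMultilinearSeries.partialSum, binomialSeries, mul_comm]

/-- Expanding `(1 + ε y i y j) ^ α` turns the form at `v` into `∑ₖ choose(α, k) εᵏ (∑ᵢ v i y iᵏ)²`.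
The terms with `k < p + 2` vanish, and the term `k = p + 2` is negative and dominates for small `ε >
0`. -/
theorem not_entrywisePreserver_of_nonint {f : ℝ → ℝ} {α : ℝ} {p : ℕ} (h1 : p < α) (h2 : α < p + 1)
    (hf : ∀ x, 0 < x → f x = x ^ α) : ¬ EntrywisePreserver f (Fin (p + 3)) := by
  intro hP
  let v : Fin (p + 3) → ℝ := fun i => differenceCoeff (p + 2) i
  let y : Fin (p + 3) → ℝ := fun i => (i : ℕ)
  have hy (i) : 0 ≤ y i := Nat.cast_nonneg _
  have hzero {k : ℕ} (hk : k < p + 2) : ∑ i, v i * y i ^ k = 0 := by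
    simpa [v, y] using sum_differenceCoeff_mul_pow hk 0
  have hself : ∑ i, v i * y i ^ (p + 2) = (p + 2).factorial := by
    simpa [v, y] using sum_differenceCoeff_mul_pow_self (p + 2) 0
  let q : ℝ → ℝ := fun ε => ∑ i, ∑ j, v i * v j * (1 + ε * (y i * y j)) ^ α
  have hq : ∀ ε, 0 < ε → 0 ≤ q ε := by
    intro ε hε
    have hA : (Matrix.of fun i j => 1 + ε * (y i * y j)).PosSemidef := by
      have := (posSemidef_gram_real fun (_ : Unit) (_ : Fin (p + 3)) => (1 : ℝ)).add
        ((posSemidef_gram_real fun _ : Unit => y).smul hε.le)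
      convert this using 1
      ext i j
      simp
    refine ((posSemidef_real_iff.mp (hP _ hA)).2 v).trans_eq ?_
    refine Finset.sum_congr rfl fun i _ => Finset.sum_congr rfl fun j _ => ?_
    rw [Matrix.map_apply, Matrix.of_apply, hf]
    have := mul_nonneg hε.le (mul_nonneg (hy i) (hy j))
    linarith
  set c := Ring.choose α (p + 2) * ((p + 2).factorial : ℝ) ^ 2 with hc
  have hcneg : c < 0 := mul_neg_of_neg_of_pos (ring_choose_neg h1 h2) (by positivity)
  have hO : (fun ε => q ε - c * ε ^ (p + 2)) =O[𝓝 0] fun ε : ℝ => ε ^ (p + 3) := by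
    have hij (i j) : (fun ε : ℝ => v i * v j * ((1 + ε * (y i * y j)) ^ α -
        ∑ k ∈ Finset.range (p + 3), Ring.choose α k * (ε * (y i * y j)) ^ k)) =O[𝓝 0]
        fun ε : ℝ => ε ^ (p + 3) := by
      have ht : Tendsto (fun ε : ℝ => ε * (y i * y j)) (𝓝 0) (𝓝 0) := by
        have : Continuous fun ε : ℝ => ε * (y i * y j) := by fun_prop
        simpa using this.tendsto 0
      refine (((one_add_rpow_isBigO α (p + 3)).comp_tendsto ht).const_mul_left _).trans ?_
      simp only [Function.comp_def, mul_pow]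
      simpa [mul_comm] using
        (Asymptotics.isBigO_refl (fun ε : ℝ => ε ^ (p + 3)) (𝓝 0)).const_mul_left
          (y i ^ (p + 3) * y j ^ (p + 3))
    have hsum := Asymptotics.IsBigO.sum (s := Finset.univ) fun i _ =>
      Asymptotics.IsBigO.sum (s := Finset.univ) fun j _ => hij i j
    refine hsum.congr_left fun ε => ?_
    have e : ∑ i, ∑ j, v i * v j *
        ∑ k ∈ Finset.range (p + 3), Ring.choose α k * (ε * (y i * y j)) ^ k = c * ε ^ (p + 2) := by
      have e (i j) : v i * v j *
          ∑ k ∈ Finset.range (p + 3), Ring.choose α k * (ε * (y i * y j)) ^ k =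
          ∑ k ∈ Finset.range (p + 3), Ring.choose α k * ε ^ k * (v i * v j * (y i * y j) ^ k) := by
        rw [Finset.mul_sum]
        refine Finset.sum_congr rfl fun k _ => ?_
        ring
      simp only [e]
      rw [Finset.sum_congr rfl fun i _ => Finset.sum_comm, Finset.sum_comm]
      simp only [← Finset.mul_sum, sum_sum_mul_pow]
      rw [Finset.sum_range_succ, Finset.sum_eq_zero fun k hk => ?_, hself]
      · rw [hc]
        ring
      · rw [hzero (Finset.mem_range.mp hk)]
        simp
    rw [← e]
    simp only [q, mul_sub, Finset.sum_sub_distrib, Finset.sum_apply]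
  have ho : (fun ε : ℝ => ε ^ (p + 3)) =o[𝓝 0] fun ε : ℝ => ε ^ (p + 2) :=
    Asymptotics.isLittleO_pow_pow (by omega)
  have hbound := (hO.trans_isLittleO ho).def (c := -c / 2) (by linarith)
  obtain ⟨ε, hε, hpos⟩ := ((hbound.filter_mono nhdsWithin_le_nhds).and
    (self_mem_nhdsWithin : Set.Ioi (0 : ℝ) ∈ 𝓝[>] 0)).exists
  have hε0 : 0 < ε ^ (p + 2) := pow_pos hpos _
  rw [Real.norm_eq_abs, Real.norm_eq_abs, abs_of_pos hε0] at hε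
  have := (le_abs_self _).trans hε
  nlinarith [hq ε hpos, mul_neg_of_neg_of_pos hcneg hε0]

/-! ### Negative exponents and the necessary conditions -/

theorem not_entrywisePreserver_of_neg {f : ℝ → ℝ} {α : ℝ} (hα : α < 0)
    (hf : ∀ x, 0 < x → f x = x ^ α) : ¬ EntrywisePreserver f (Fin 2) := by
  intro h
  have hA : (!![1, 1 / 2; 1 / 2, 1] : Matrix (Fin 2) (Fin 2) ℝ).PosSemidef := by
    refine posSemidef_real_iff.mpr ⟨fun i j => by fin_cases i <;> fin_cases j <;> rfl, fun x => ?_⟩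
    simp [Fin.sum_univ_two]
    nlinarith [sq_nonneg (x 0 + x 1), sq_nonneg (x 0), sq_nonneg (x 1)]
  have h1 := (posSemidef_real_iff.mp (h _ hA)).2 ![1, -1]
  have h2 : (1 : ℝ) < (1 / 2 : ℝ) ^ α :=
    Real.one_lt_rpow_of_pos_of_lt_one_of_neg (by norm_num) (by norm_num) hα
  simp only [Fin.sum_univ_two, Matrix.map_apply, Matrix.of_apply, Matrix.cons_val_zero,
    Matrix.cons_val_one, hf 1 one_pos, hf (1 / 2) (by norm_num), Real.one_rpow] at h1
  linarith

theorem not_entrywisePreserver_of_lt {f : ℝ → ℝ} {α : ℝ} {n : ℕ} (hn : 2 ≤ n) (hα0 : α ≠ 0)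
    (hα : α < n - 2) (hf : ∀ x, 0 < x → f x = x ^ α)
    (hint : ∀ p : ℕ, α = p → ∀ x < 0, f x = -x ^ p) : ¬ EntrywisePreserver f (Fin n) := by
  intro h
  rcases hα0.lt_or_gt with hneg | hpos
  · exact not_entrywisePreserver_of_neg hneg hf (h.of_injective _ (Fin.castLE_injective hn))
  have hfloor := Nat.floor_le hpos.le
  -- Both remaining counterexamples have size `⌊α⌋₊ + 3`, which is exactly what `α < n - 2`
  -- accommodates.
  have hlt : ⌊α⌋₊ + 3 ≤ n := by
    have : ((⌊α⌋₊ + 2 : ℕ) : ℝ) < n := by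
      push_cast
      linarith
    exact_mod_cast this
  rcases hfloor.lt_or_eq with hlt' | heq
  · exact not_entrywisePreserver_of_nonint hlt' (Nat.lt_floor_add_one α) hf
      (h.of_injective _ (Fin.castLE_injective hlt))
  · obtain ⟨e⟩ : Nonempty (Option (Fin (⌊α⌋₊ + 2)) ↪ Fin n) :=
      Function.Embedding.nonempty_of_card_le
        (by simpa [Fintype.card_option] using Nat.lt_of_succ_le hlt)
    refine not_entrywisePreserver_of_integer (p := ⌊α⌋₊) (fun x hx => ?_) (hint _ heq.symm)
      (h.of_injective e e.injective)
    rw [hf x hx, ← Real.rpow_natCast, heq]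

theorem not_entrywisePreserver_phi {n : ℕ} (hn : 2 ≤ n) {α : ℝ} (hα0 : α ≠ 0)
    (hα : α ∉ phiPowers n) : ¬ EntrywisePreserver (phi α) (Fin n) := by
  rw [phiPowers, Set.mem_union, not_or] at hα
  refine not_entrywisePreserver_of_lt hn hα0 (not_le.mp hα.2) (fun x => phi_of_pos) ?_
  rintro p rfl x hx
  -- Even `p ≥ 2` lies in `phiPowers`, and `p = 0` is excluded by `α ≠ 0`.
  have hodd : Odd p := by
    by_contra hp
    obtain ⟨k, rfl⟩ := even_iff_two_dvd.mp (Nat.not_odd_iff_even.mp hp)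
    refine hα.1 ⟨k, Nat.one_le_iff_ne_zero.mpr ?_, by push_cast; ring⟩
    rintro rfl
    simp at hα0
  rw [phi_of_neg hx, Real.rpow_natCast, hodd.neg_pow]

theorem not_entrywisePreserver_psi {n : ℕ} (hn : 2 ≤ n) {α : ℝ} (hα0 : α ≠ 0)
    (hα : α ∉ psiPowers n) : ¬ EntrywisePreserver (psi α) (Fin n) := by
  rw [psiPowers, Set.mem_union, not_or] at hα
  refine not_entrywisePreserver_of_lt hn hα0 (not_le.mp hα.2) (fun x => psi_of_pos) ?_
  rintro p rfl x hx
  have heven : Even p := by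
    by_contra hp
    obtain ⟨k, rfl⟩ := Nat.not_even_iff_odd.mp hp
    exact hα.1 ⟨k + 1, by omega, by push_cast; ring⟩
  rw [psi_of_neg hx, Real.rpow_natCast, heven.neg_pow]

/-! ### Reduction to real matrices -/

/-- Commuting Hermitian matrices are simultaneously unitarily diagonalizable. -/
theorem exists_unitary_diagonal_of_commute {𝕜 : Type*} [RCLike 𝕜] {ι : Type*} [Finite ι] {m : ℕ}
    (A : ι → Matrix (Fin m) (Fin m) 𝕜) (hA : ∀ i, (A i).IsHermitian)
    (hc : ∀ i j, Commute (A i) (A j)) :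
    ∃ U ∈ unitaryGroup (Fin m) 𝕜, ∃ d : ι → Fin m → ℝ,
      ∀ i, A i = U * diagonal (fun a => (d i a : 𝕜)) * star U := by
  classical
  let T : ι → EuclideanSpace 𝕜 (Fin m) →ₗ[𝕜] EuclideanSpace 𝕜 (Fin m) :=
    fun i => toEuclideanLin (A i)
  have hT (i) : (T i).IsSymmetric := isSymmetric_toEuclideanLin_iff.mpr (hA i)
  have hC : Pairwise (Function.onFun Commute T) := fun i j _ => by
    have := (hc i j).eq
    ext v k
    have := congrFun (congrArg (fun M => M *ᵥ v.ofLp) this) k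
    simpa [T, toLpLin_apply, Matrix.mulVec_mulVec] using this
  have hint := LinearMap.IsSymmetric.directSum_isInternal_of_pairwise_commute hT hC
  have horth := LinearMap.IsSymmetric.orthogonalFamily_iInf_eigenspaces hT
  let V : (ι → 𝕜) → Submodule 𝕜 (EuclideanSpace 𝕜 (Fin m)) :=
    fun χ => ⨅ j, Module.End.eigenspace (T j) (χ j)
  -- The joint eigenspaces are indexed by all families of scalars; only finitely many are nonzero,
  -- and an orthonormal basis is chosen inside those.
  have : Finite {χ // V χ ≠ ⊥} :=
    (WellFoundedGT.finite_ne_bot_of_iSupIndep hint.submodule_iSupIndep).to_subtype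
  have := Fintype.ofFinite {χ // V χ ≠ ⊥}
  have hint' := DirectSum.isInternal_ne_bot_iff.mpr hint
  have horth' : OrthogonalFamily 𝕜 (fun χ : {χ // V χ ≠ ⊥} => V χ) fun χ => (V χ).subtypeₗᵢ :=
    horth.comp Subtype.val_injective
  have hm : Module.finrank 𝕜 (EuclideanSpace 𝕜 (Fin m)) = m := by simp
  let b := hint'.subordinateOrthonormalBasis hm horth'
  let χ : Fin m → ι → 𝕜 := fun a => (hint'.subordinateOrthonormalBasisIndex hm a horth').1
  have hb (a : Fin m) (i : ι) : T i (b a) = χ a i • b a := by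
    have h := hint'.subordinateOrthonormalBasis_subordinate hm a horth'
    exact Module.End.mem_eigenspace_iff.mp ((Submodule.mem_iInf _).mp h i)
  have hreal (a : Fin m) (i : ι) : ((RCLike.re (χ a i) : ℝ) : 𝕜) = χ a i := by
    refine RCLike.conj_eq_iff_re.mp ((hT i).conj_eigenvalue_eq_self ?_)
    exact Module.End.hasEigenvalue_of_hasEigenvector
      ⟨Module.End.mem_eigenspace_iff.mpr (hb a i), b.orthonormal.ne_zero a⟩
  let U : Matrix (Fin m) (Fin m) 𝕜 := (EuclideanSpace.basisFun (Fin m) 𝕜).toBasis.toMatrix b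
  have hU : U ∈ unitaryGroup (Fin m) 𝕜 :=
    (EuclideanSpace.basisFun (Fin m) 𝕜).toMatrix_orthonormalBasis_mem_unitary b
  refine ⟨U, hU, fun i a => RCLike.re (χ a i), fun i => ?_⟩
  have hAU : A i * U = U * diagonal (fun a => ((RCLike.re (χ a i) : ℝ) : 𝕜)) := by
    ext k a
    rw [mul_diagonal, hreal]
    have h := congrArg (fun v => v.ofLp k) (hb a i)
    simpa [T, toLpLin_apply, mulVec, dotProduct, Matrix.mul_apply, U,
      Module.Basis.toMatrix_apply, mul_comm] using h
  rw [← hAU, mul_assoc, mem_unitaryGroup_iff.mp hU, mul_one]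

/-! ### Functional calculus in a diagonalizing basis -/

theorem aeval_unitary_conj_diagonal {𝕜 : Type*} [RCLike 𝕜] {ι : Type*} [Fintype ι] [DecidableEq ι]
    {U : Matrix ι ι 𝕜} (hU : U ∈ unitaryGroup ι 𝕜) (d : ι → ℝ) (q : Polynomial ℝ) :
    Polynomial.aeval (U * diagonal (fun a => (d a : 𝕜)) * star U) q =
      U * diagonal (fun a => ((q.eval (d a) : ℝ) : 𝕜)) * star U := by
  have hpow (k : ℕ) : (U * diagonal (fun a => (d a : 𝕜)) * star U) ^ k =
      U * diagonal (fun a => ((d a ^ k : ℝ) : 𝕜)) * star U := by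
    induction k with
    | zero => simp [mem_unitaryGroup_iff.mp hU]
    | succ k ih =>
      rw [pow_succ, ih]
      calc _ = U * diagonal (fun a => ((d a ^ k : ℝ) : 𝕜)) * (star U * U) *
            diagonal (fun a => (d a : 𝕜)) * star U := by simp only [mul_assoc]
        _ = _ := by
          rw [mem_unitaryGroup_iff'.mp hU, mul_one, mul_assoc U, diagonal_mul_diagonal]
          simp [pow_succ]
  induction q using Polynomial.induction_on' with
  | add p q hp hq =>
    rw [map_add, hp, hq, ← add_mul, ← mul_add, diagonal_add]
    simp
  | monomial k c =>
    rw [Polynomial.aeval_monomial, hpow, ← Algebra.smul_def, ← smul_mul_assoc, ← mul_smul_comm,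
      ← diagonal_smul]
    congr 3
    ext a
    simp [RCLike.real_smul_eq_coe_mul]

/-- The functional calculus of a unitarily diagonalized matrix acts on the diagonal. -/
theorem cfc_unitary_conj_diagonal {𝕜 : Type*} [RCLike 𝕜] {ι : Type*} [Fintype ι] [DecidableEq ι]
    {U : Matrix ι ι 𝕜} (hU : U ∈ unitaryGroup ι 𝕜) (d : ι → ℝ) (f : ℝ → ℝ) :
    cfc f (U * diagonal (fun a => (d a : 𝕜)) * star U) =
      U * diagonal (fun a => ((f (d a) : ℝ) : 𝕜)) * star U := by
  set A := U * diagonal (fun a => (d a : 𝕜)) * star U with hAdef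
  have hA : A.IsHermitian := by
    refine isHermitian_mul_mul_conjTranspose U ?_
    exact isHermitian_diagonal_iff.mpr fun a => by simp [isSelfAdjoint_iff]
  -- Interpolating `f` on the entries `d` and on Mathlib's eigenvalues at once gives one polynomial
  -- in `A` that computes both sides, so the choice of diagonalization is immaterial.
  let s : Finset ℝ := Finset.univ.image d ∪ Finset.univ.image hA.eigenvalues
  let q : Polynomial ℝ := Lagrange.interpolate s id f
  have hq (x) (hx : x ∈ s) : q.eval x = f x :=
    Lagrange.eval_interpolate_at_node f Function.injective_id.injOn hx
  have hqd (a) : q.eval (d a) = f (d a) := hq _ (by simp [s])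
  have hqe (a) : q.eval (hA.eigenvalues a) = f (hA.eigenvalues a) := hq _ (by simp [s])
  have hspec : A = hA.eigenvectorUnitary * diagonal (fun a => (hA.eigenvalues a : 𝕜)) *
      star (hA.eigenvectorUnitary : Matrix ι ι 𝕜) := by
    conv_lhs => rw [hA.spectral_theorem, Unitary.conjStarAlgAut_apply]
    rfl
  rw [hA.cfc_eq, Matrix.IsHermitian.cfc, Unitary.conjStarAlgAut_apply]
  have h1 := aeval_unitary_conj_diagonal hU d q
  have h2 := aeval_unitary_conj_diagonal hA.eigenvectorUnitary.2 hA.eigenvalues q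
  rw [← hspec] at h2
  rw [← hAdef, h2] at h1
  simp only [hqd, hqe] at h1
  exact h1

/-! ### Transfer between block matrices and joint eigenvalue matrices -/

open scoped MatrixOrder in
theorem Matrix.PosSemidef.exists_eq_conjTranspose_mul_self {𝕜 : Type*} [RCLike 𝕜]
    {ι : Type*} [Fintype ι] [DecidableEq ι] {A : Matrix ι ι 𝕜} (hA : A.PosSemidef) :
    ∃ B : Matrix ι ι 𝕜, A = Bᴴ * B :=
  CStarAlgebra.nonneg_iff_eq_star_mul_self.mp hA.nonneg

theorem posSemidef_map_ofReal_iff {𝕜 : Type*} [RCLike 𝕜] {ι : Type*} [Fintype ι]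
    {A : Matrix ι ι ℝ} : (A.map ((↑) : ℝ → 𝕜)).PosSemidef ↔ A.PosSemidef := by
  constructor
  · intro h
    refine posSemidef_real_iff.mpr ⟨fun i j => ?_, fun x => ?_⟩
    · have := h.isHermitian.apply j i
      simpa using this
    · have := h.dotProduct_mulVec_nonneg fun i => (x i : 𝕜)
      have e : star (fun i => (x i : 𝕜)) ⬝ᵥ (A.map ((↑) : ℝ → 𝕜) *ᵥ fun i => (x i : 𝕜)) =
          ((∑ i, ∑ j, x i * x j * A i j : ℝ) : 𝕜) := by
        simp only [dotProduct, mulVec, Finset.mul_sum]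
        push_cast
        refine Finset.sum_congr rfl fun i _ => Finset.sum_congr rfl fun j _ => ?_
        simp
        ring
      rw [e] at this
      exact_mod_cast this
  · intro h
    classical
    obtain ⟨B, rfl⟩ := h.exists_eq_conjTranspose_mul_self
    convert posSemidef_conjTranspose_mul_self (B.map ((↑) : ℝ → 𝕜)) using 1
    ext i j
    simp [Matrix.mul_apply]

theorem posSemidef_blockDiagonal_iff {𝕜 : Type*} [RCLike 𝕜] {ι κ : Type*} [Fintype ι] [Fintype κ]
    [DecidableEq κ] {A : κ → Matrix ι ι 𝕜} :
    (blockDiagonal A).PosSemidef ↔ ∀ k, (A k).PosSemidef := by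
  constructor
  · intro h k
    convert h.submatrix fun i => (i, k) using 1
    ext i j
    simp
  · intro h
    classical
    choose B hB using fun k => (h k).exists_eq_conjTranspose_mul_self
    convert posSemidef_conjTranspose_mul_self (blockDiagonal B) using 1
    rw [blockDiagonal_conjTranspose, ← blockDiagonal_mul]
    exact congrArg _ (funext hB)

/-- A simultaneously diagonalized block matrix is positive semidefinite if and only if the matrices
formed by the joint eigenvalues of the blocks are. -/
theorem posSemidef_flatten_iff {𝕜 : Type*} [RCLike 𝕜] {n m : ℕ}
    {U : Matrix (Fin m) (Fin m) 𝕜} (hU : U ∈ unitaryGroup (Fin m) 𝕜)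
    (d : Fin n → Fin n → Fin m → ℝ) :
    (flatten (Matrix.of fun s t => U * diagonal (fun a => (d s t a : 𝕜)) * star U)).PosSemidef ↔
      ∀ a, (Matrix.of fun s t => d s t a).PosSemidef := by
  -- `W = 1 ⊗ U`. Since `blockDiagonal` groups the pairs `(s, a)` by `a`, no permutation of indices
  -- is needed.
  let W : Matrix (Fin n × Fin m) (Fin n × Fin m) 𝕜 := kroneckerMap (· * ·) 1 U
  have hW : W ∈ unitary (Matrix (Fin n × Fin m) (Fin n × Fin m) 𝕜) :=
    kronecker_mem_unitary (one_mem _) hU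
  let D : Fin m → Matrix (Fin n) (Fin n) 𝕜 := fun a => (Matrix.of fun s t => d s t a).map (↑)
  have e : flatten (Matrix.of fun s t => U * diagonal (fun a => (d s t a : 𝕜)) * star U) =
      W * blockDiagonal D * star W := by
    ext ⟨s, i⟩ ⟨t, j⟩
    simp only [flatten, comp_apply, of_apply, W, D, Matrix.mul_apply, Fintype.sum_prod_type,
      kroneckerMap_apply, blockDiagonal_apply, star_apply, one_apply, map_apply, diagonal_apply]
    simp [apply_ite (starRingEnd 𝕜)]
  rw [e, (Unitary.isUnit_coe (U := ⟨W, hW⟩)).posSemidef_star_right_conjugate_iff,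
    posSemidef_blockDiagonal_iff]
  exact forall_congr' fun a => posSemidef_map_ofReal_iff

theorem blockMap_unitary_conj_diagonal {𝕜 : Type*} [RCLike 𝕜] {n m : ℕ} (f : ℝ → ℝ)
    {U : Matrix (Fin m) (Fin m) 𝕜} (hU : U ∈ unitaryGroup (Fin m) 𝕜)
    (d : Fin n → Fin n → Fin m → ℝ) :
    blockMap f (Matrix.of fun s t => U * diagonal (fun a => (d s t a : 𝕜)) * star U) =
      Matrix.of fun s t => U * diagonal (fun a => ((f (d s t a) : ℝ) : 𝕜)) * star U := by
  ext1 s t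
  exact cfc_unitary_conj_diagonal hU (d s t) f

theorem EntrywisePreserver.posSemidef_blockMap {𝕜 : Type*} [RCLike 𝕜] {n m : ℕ} {f : ℝ → ℝ}
    (hf : EntrywisePreserver f (Fin n)) {H : Matrix (Fin n) (Fin n) (Matrix (Fin m) (Fin m) 𝕜)}
    (hH : HermitianCommutingBlocks H) (hpos : (flatten H).PosSemidef) :
    (flatten (blockMap f H)).PosSemidef := by
  obtain ⟨U, hU, d, hd⟩ := exists_unitary_diagonal_of_commute
    (fun st : Fin n × Fin n => H st.1 st.2) (fun _ => hH.1 _ _) fun _ _ => hH.2 _ _ _ _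
  obtain rfl : H = Matrix.of fun s t => U * diagonal (fun a => (d (s, t) a : 𝕜)) * star U := by
    ext1 s t
    exact hd (s, t)
  rw [blockMap_unitary_conj_diagonal f hU fun s t => d (s, t), posSemidef_flatten_iff hU
    fun s t a => f (d (s, t) a)]
  exact fun a => hf _ ((posSemidef_flatten_iff hU fun s t => d (s, t)).mp hpos a)

theorem exists_not_posSemidef_blockMap (𝕜 : Type*) [RCLike 𝕜] {n m : ℕ} (hm : 0 < m) {f : ℝ → ℝ}
    (hf : ¬ EntrywisePreserver f (Fin n)) :
    ∃ H : Matrix (Fin n) (Fin n) (Matrix (Fin m) (Fin m) 𝕜),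
      HermitianCommutingBlocks H ∧ (flatten H).PosSemidef ∧
      ¬ (flatten (blockMap f H)).PosSemidef := by
  simp only [EntrywisePreserver, not_forall] at hf
  obtain ⟨A, hA, hfA⟩ := hf
  have h1 : (1 : Matrix (Fin m) (Fin m) 𝕜) ∈ unitaryGroup (Fin m) 𝕜 := one_mem _
  -- Scalar blocks `A s t • 1`, written as a conjugation by `1` to fit the diagonalization lemmas.
  refine ⟨Matrix.of fun s t => 1 * diagonal (fun _ => (A s t : 𝕜)) * star 1, ⟨fun s t => ?_,
    fun s t u v => ?_⟩, ?_, ?_⟩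
  · refine isHermitian_mul_mul_conjTranspose (1 : Matrix (Fin m) (Fin m) 𝕜) ?_
    exact isHermitian_diagonal_iff.mpr fun a => by simp [isSelfAdjoint_iff]
  · simp [Commute, SemiconjBy, mul_comm]
  · exact (posSemidef_flatten_iff h1 fun s t _ => A s t).mpr fun _ => hA
  · rw [blockMap_unitary_conj_diagonal f h1 fun s t _ => A s t,
      posSemidef_flatten_iff h1 fun s t _ => f (A s t)]
    exact fun h => hfA (h ⟨0, hm⟩)

/-- The counterexample is needed over `ℂ` for the equivalence and over `ℝ` for the supplement, which
is why the lift is made for general `𝕜`. -/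
theorem blockMap_characterization {n m : ℕ} (hm : 0 < m) {f : ℝ → ℝ} {p : Prop}
    (hpos : p → EntrywisePreserver f (Fin n)) (hneg : ¬ p → ¬ EntrywisePreserver f (Fin n)) :
    ((∀ H : Matrix (Fin n) (Fin n) (Matrix (Fin m) (Fin m) ℂ),
        HermitianCommutingBlocks H → (flatten H).PosSemidef →
        (flatten (blockMap f H)).PosSemidef) ↔ p) ∧
      (¬ p → ∃ H : Matrix (Fin n) (Fin n) (Matrix (Fin m) (Fin m) ℝ),
        HermitianCommutingBlocks H ∧ (flatten H).PosSemidef ∧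
        ¬ (flatten (blockMap f H)).PosSemidef) := by
  refine ⟨⟨fun h => ?_, fun hp H h1 h2 => (hpos hp).posSemidef_blockMap h1 h2⟩,
    fun hp => exists_not_posSemidef_blockMap ℝ hm (hneg hp)⟩
  by_contra hp
  obtain ⟨H, h1, h2, h3⟩ := exists_not_posSemidef_blockMap ℂ hm (hneg hp)
  exact h3 (h H h1 h2)

theorem mainTheorem6 (α : ℝ) (hα : α ≠ 0) (m n : ℕ) (hm : 2 ≤ m) (hn : 2 ≤ n) :
    (((∀ H : Matrix (Fin n) (Fin n) (Matrix (Fin m) (Fin m) ℂ),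
          HermitianCommutingBlocks H → (flatten H).PosSemidef →
          (flatten (blockMap (phi α) H)).PosSemidef) ↔ α ∈ phiPowers n) ∧
      (α ∉ phiPowers n →
        ∃ H : Matrix (Fin n) (Fin n) (Matrix (Fin m) (Fin m) ℝ),
          HermitianCommutingBlocks H ∧ (flatten H).PosSemidef ∧
          ¬ (flatten (blockMap (phi α) H)).PosSemidef)) ∧
    (((∀ H : Matrix (Fin n) (Fin n) (Matrix (Fin m) (Fin m) ℂ),
          HermitianCommutingBlocks H → (flatten H).PosSemidef →
          (flatten (blockMap (psi α) H)).PosSemidef) ↔ α ∈ psiPowers n) ∧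
      (α ∉ psiPowers n →
        ∃ H : Matrix (Fin n) (Fin n) (Matrix (Fin m) (Fin m) ℝ),
          HermitianCommutingBlocks H ∧ (flatten H).PosSemidef ∧
          ¬ (flatten (blockMap (psi α) H)).PosSemidef)) := by
  have hm' : 0 < m := by omega
  exact ⟨blockMap_characterization hm' (entrywisePreserver_phi hn)
      (not_entrywisePreserver_phi hn hα),
    blockMap_characterization hm' (entrywisePreserver_psi hn) (not_entrywisePreserver_psi hn hα)⟩
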